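/- Consider $N$ sensors; sensor $j$ observes $L_j$ subvectors $\mathbf{x}_{jl}$, whose joint law $P^{\boldsymbol\theta}$ depends on a parameter $\boldsymbol\theta\in\boldsymbol\Theta\subset\mathbb{R}^{D_{\boldsymbol\theta}}$, where $\boldsymbol\Theta$ has nonempty interior. Each $\mathbf{x}_{jl}$ is quantized to $u_{jl}=\gamma_{jl}(\mathbf{x}_{jl})=\sum_{r=1}^{R_{jl}} r\,\mathbb{1}\{\mathbf{x}_{jl}\in I_{jl}^{(r)}\}$, where the measurable regions $I_{jl}^{(1)},\dots,I_{jl}^{(R_{jl})}$ are disjoint and cover the sample space of $\mathbf{x}_{jl}$. Let $\mathbf{u}=(u_{jl})_{j,l}$, and let $q_j^{(\mathbf{s})}(\boldsymbol\theta)=P^{\boldsymbol\theta}\big((u_{j1},\dots,u_{jL_j})=\mathbf{s}\big)$ for each $j$ and each possible outcome $\mathbf{s}$. Suppose that for every $\boldsymbol\theta\in\boldsymbol\Theta$ all the subvectors $\mathbf{x}_{jl}$ are independent, and that the set of indices $(j,l)$ is the disjoint union of nonempty groups $\mathcal{A}_w^{(t)}$, $1\le w\le W$, $1\le t\le T_w$,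 such that for each $w$ all subvectors with index in $\mathcal{A}_w=\bigcup_t\mathcal{A}_w^{(t)}$ follow the same statistical model $(\tilde{\mathscr{X}}_w,\tilde{\mathscr{F}}_w,\tilde{\mathscr{P}}_w^{\boldsymbol\theta})$, and all subvectors with index in $\mathcal{A}_w^{(t)}$ are moreover quantized by the same quantizer, with $\tilde R_w^{(t)}$ levels. Assume $$D_{\boldsymbol\theta}>\sum_{w=1}^{W}\sum_{t=1}^{T_w}\big(\tilde R_w^{(t)}-1\big).$$ (1) If all the functions $q_j^{(\mathbf{s})}$ are twice differentiable on $\boldsymbol\Theta$, then the Fisher information matrix $$\mathbf{J}(\boldsymbol\theta)=\sum_{j=1}^{N}\sum_{\mathbf{s}:\,q_j^{(\mathbf{s})}(\boldsymbol\theta)\neq0}\frac{1}{q_j^{(\mathbf{s})}(\boldsymbol\theta)}\,\frac{\partial q_j^{(\mathbf{s})}(\boldsymbol\theta)}{\partial\boldsymbol\theta}\Big[\frac{\partial q_j^{(\mathbf{s})}(\boldsymbol\theta)}{\partial\boldsymbol\theta}\Big]^{T}$$ is singular at every $\boldsymbol\theta\in\boldsymbol\Theta$ at which derivatives within $\boldsymbol\Theta$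 are uniquely determined (in particular at every interior point). Also, the matrix with entries $-\mathbb{E}_{\boldsymbol\theta}\{\partial^2\ln\Pr(\mathbf{u}|\boldsymbol\theta)/\partial\theta_l\,\partial\theta_m\}$ is singular at every $\boldsymbol\theta\in\boldsymbol\Theta$ such that derivatives within $\boldsymbol\Theta$ are uniquely determined at all points of $\boldsymbol\Theta$ near $\boldsymbol\theta$, and such that each value of $\mathbf{u}$ which has probability $0$ under $\boldsymbol\theta$ has probability $0$ under all points of $\boldsymbol\Theta$ near $\boldsymbol\theta$. (2) If all the functions $q_j^{(\mathbf{s})}$ are continuous on $\boldsymbol\Theta$, then $\boldsymbol\Theta$ is not identifiable, i.e. some point of $\boldsymbol\Theta$ is not identifiable. Moreover, every nonempty subset $\mathcal{U}\subset\boldsymbol\Theta$ that is open in $\mathbb{R}^{D_{\boldsymbol\theta}}$ contains infinitely many points which are not identifiable. Here $\boldsymbol\theta\in\boldsymbol\Theta$ is called identifiable if there is no $\boldsymbol\theta'\in\boldsymbol\Theta\setminus\{\boldsymbol\theta\}$ with $\Pr(\mathbf{u}|\boldsymbol\theta)=\Pr(\mathbf{u}|\boldsymbol\theta')$ for all possible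 values of $\mathbf{u}$. -/

import Mathlib

open MeasureTheory ProbabilityTheory Topology Filter

noncomputable section

/-- The parameter lives in `ℝ^D` with its Euclidean structure. -/
abbrev ParamSpace (D : ℕ) : Type := EuclideanSpace ℝ (Fin D)

/-- Indices `(j, l)` of the observation subvectors: sensor `j` has `L j` subvectors. -/
abbrev SubvectorIndex {N : ℕ} (L : Fin N → ℕ) : Type := Σ j : Fin N, Fin (L j)

/-- An `R`-level vector quantizer on `X`, given by its quantization regions, which are
measurable, pairwise disjoint and cover `X`.  The region with label `r = 1, …, R` is
`region` at the element `r - 1` of `Fin R`. -/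
structure VectorQuantizer (X : Type*) [MeasurableSpace X] (R : ℕ) where
  region : Fin R → Set X
  measurableSet_region : ∀ r, MeasurableSet (region r)
  disjoint_region : Pairwise fun r r' => Disjoint (region r) (region r')
  cover : (⋃ r, region r) = Set.univ

namespace VectorQuantizer

variable {X : Type*} [MeasurableSpace X] {R : ℕ}

open Classical in
/-- The quantizer map `γ(x) = ∑_{r=1}^R r · 1{x ∈ I^(r)}`. -/
def output (γ : VectorQuantizer X R) (x : X) : ℕ :=
  ∑ r : Fin R, if x ∈ γ.region r then (r : ℕ) + 1 else 0

theorem output_eq_of_mem (γ : VectorQuantizer X R) {x : X} {r : Fin R}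
    (h : x ∈ γ.region r) : γ.output x = (r : ℕ) + 1 := by
  classical
  unfold output
  rw [Finset.sum_eq_single r]
  · simp [h]
  · intro r' _ hne
    rw [if_neg]
    exact fun h' => Set.disjoint_left.mp (γ.disjoint_region hne) h' h
  · simp

theorem output_eq_iff (γ : VectorQuantizer X R) (x : X) (r : Fin R) :
    γ.output x = (r : ℕ) + 1 ↔ x ∈ γ.region r := by
  refine ⟨fun h => ?_, γ.output_eq_of_mem⟩
  have hx : x ∈ ⋃ r, γ.region r := γ.cover ▸ Set.mem_univ x
  obtain ⟨r', hr'⟩ := Set.mem_iUnion.mp hx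
  rw [γ.output_eq_of_mem hr'] at h
  have : r' = r := Fin.ext (by omega)
  exact this ▸ hr'

end VectorQuantizer

/-- Partial derivative `∂f/∂θ_l` at `θ` of a function on the parameter set `Θ`
(only the values of `f` on `Θ` matter; in the interior it is the usual partial derivative). -/
def partialWithin {D : ℕ} (Θ : Set (ParamSpace D)) (l : Fin D) (f : ParamSpace D → ℝ)
    (θ : ParamSpace D) : ℝ :=
  fderivWithin ℝ f Θ θ (EuclideanSpace.single l 1)

/-- `f` is twice differentiable on `Θ`: it has, on `Θ`, a derivative which is itself
differentiable on `Θ`. -/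
def TwiceDifferentiableOn {D : ℕ} (f : ParamSpace D → ℝ) (Θ : Set (ParamSpace D)) : Prop :=
  ∃ f' : ParamSpace D → (ParamSpace D →L[ℝ] ℝ),
    (∀ θ ∈ Θ, HasFDerivWithinAt f (f' θ) Θ θ) ∧ DifferentiableOn ℝ f' Θ

/-! A quantized estimation system: a family `P θ` of laws on `Ω`, the observation subvectors
`x (j, l) : Ω → X (j, l)`, and a vector quantizer `γ (j, l)` for each of them. -/
section System

variable {D N : ℕ} {L : Fin N → ℕ} {Ω : Type*} [MeasurableSpace Ω]
  {X : SubvectorIndex L → Type*} [∀ i, MeasurableSpace (X i)] {R : SubvectorIndex L → ℕ}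

/-- `q_j^(s)(θ)`: the probability under `P θ` that the superquantizer `Γ_j` of sensor `j`
outputs `s`. -/
def outcomeProb (P : ParamSpace D → Measure Ω) (x : ∀ i, Ω → X i)
    (γ : ∀ i, VectorQuantizer (X i) (R i)) (j : Fin N) (s : ∀ l : Fin (L j), Fin (R ⟨j, l⟩))
    (θ : ParamSpace D) : ℝ :=
  (P θ).real {ω | ∀ l : Fin (L j), (γ ⟨j, l⟩).output (x ⟨j, l⟩ ω) = (s l : ℕ) + 1}

/-- `Pr(u | θ)`: the probability under `P θ` that the data received from all sensors is `u`. -/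
def dataProb (P : ParamSpace D → Measure Ω) (x : ∀ i, Ω → X i)
    (γ : ∀ i, VectorQuantizer (X i) (R i)) (u : ∀ i, Fin (R i)) (θ : ParamSpace D) : ℝ :=
  (P θ).real {ω | ∀ i, (γ i).output (x i ω) = (u i : ℕ) + 1}

/-- The Fisher information matrix
`J(θ) = ∑_j ∑_s (1 / q_j^(s)(θ)) (∂q_j^(s)/∂θ) (∂q_j^(s)/∂θ)ᵀ` for independent sensors.
Outcomes of probability zero contribute nothing (`1 / 0 = 0`). -/
def fisherInformation (Θ : Set (ParamSpace D)) (P : ParamSpace D → Measure Ω)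
    (x : ∀ i, Ω → X i) (γ : ∀ i, VectorQuantizer (X i) (R i)) (θ : ParamSpace D) :
    Matrix (Fin D) (Fin D) ℝ :=
  Matrix.of fun l m => ∑ j : Fin N, ∑ s : (∀ l : Fin (L j), Fin (R ⟨j, l⟩)),
    1 / outcomeProb P x γ j s θ *
      (partialWithin Θ l (outcomeProb P x γ j s) θ * partialWithin Θ m (outcomeProb P x γ j s) θ)

/-- The matrix `- E {∂² ln Pr(u | θ) / ∂θ_l ∂θ_m}`, the expectation being over the data `u`
under the parameter `θ`. -/
def expectedNegHessian (Θ : Set (ParamSpace D)) (P : ParamSpace D → Measure Ω)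
    (x : ∀ i, Ω → X i) (γ : ∀ i, VectorQuantizer (X i) (R i)) (θ : ParamSpace D) :
    Matrix (Fin D) (Fin D) ℝ :=
  Matrix.of fun l m => - ∑ u : (∀ i, Fin (R i)), dataProb P x γ u θ *
    partialWithin Θ l (partialWithin Θ m fun η => Real.log (dataProb P x γ u η)) θ

/-- Two distinct parameter points are observationally equivalent if they give the same
probability to all values of the data. -/
def ObservationallyEquivalent (P : ParamSpace D → Measure Ω) (x : ∀ i, Ω → X i)
    (γ : ∀ i, VectorQuantizer (X i) (R i)) (θ θ' : ParamSpace D) : Prop :=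
  θ ≠ θ' ∧ ∀ u : (∀ i, Fin (R i)), dataProb P x γ u θ = dataProb P x γ u θ'

/-- `θ` is identifiable in `Θ`: no other point of `Θ` is observationally equivalent to it. -/
def IdentifiablePoint (Θ : Set (ParamSpace D)) (P : ParamSpace D → Measure Ω)
    (x : ∀ i, Ω → X i) (γ : ∀ i, VectorQuantizer (X i) (R i)) (θ : ParamSpace D) : Prop :=
  ¬ ∃ θ' ∈ Θ \ {θ}, ObservationallyEquivalent P x γ θ θ'

/-- The parameter space `Θ` is identifiable: each of its points is. -/
def IdentifiableSpace (Θ : Set (ParamSpace D)) (P : ParamSpace D → Measure Ω)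
    (x : ∀ i, Ω → X i) (γ : ∀ i, VectorQuantizer (X i) (R i)) : Prop :=
  ∀ θ ∈ Θ, IdentifiablePoint Θ P x γ θ

end System

end

/-! ### Continuous maps into lower dimension are not injective -/

section Degree

open Polynomial Metric Set

variable {E : Type*} [NormedAddCommGroup E] [InnerProductSpace ℝ E] [FiniteDimensional ℝ E]

/-! By independence, the law of the data depends on `θ` only through the cell probabilities of the
groups. Each group's probabilities sum to one, so dropping one cell per group leaves fewer than `D`
free coordinates. Both conclusions come from this map into a space of lower dimension.

Singularity is linear algebra. The derivative of the map kills some `v ≠ 0`, hence so does the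
derivative of every outcome probability, a product of cell probabilities, and `v` lies in the kernel
of the Fisher matrix. The expected negative Hessian is the Fisher matrix of the whole data
(`neg_sum_mul_partialWithin_log_eq`), so `v` kills it too.

Nonidentifiability is topological, as the map is only continuous: `not_injOn_of_finrank_lt` gives
two points of any open set with equal cell probabilities. If a continuous injection existed,
smoothing it and its inverse would give a map close to the identity on a ball whose derivative,
factoring through the smaller space, is everywhere singular. An integral identity, proved by a
change of variables for small perturbations of the identity and extended by polynomiality, excludes
this. -/

theorem exists_polynomial_eval_eq_det_id_add_smul (A : E →L[ℝ] E) :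
    ∃ p : ℝ[X], p.natDegree ≤ Module.finrank ℝ E ∧
      ∀ t : ℝ, p.eval t = (ContinuousLinearMap.id ℝ E + t • A).det := by
  classical
  let b := Module.finBasis ℝ E
  let M := LinearMap.toMatrix b b (A : E →ₗ[ℝ] E)
  refine ⟨Matrix.det ((X : ℝ[X]) • M.map C + (1 : Matrix _ _ ℝ).map C), ?_, fun t => ?_⟩
  · simpa using natDegree_det_X_add_C_le M 1
  · rw [← Polynomial.coe_evalRingHom, RingHom.map_det, ContinuousLinearMap.det,
      ← LinearMap.det_toMatrix b]
    congr 1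
    ext i j
    rcases eq_or_ne i j with rfl | hij
    · simp [M, LinearMap.toMatrix_apply]
      ring
    · simp [M, LinearMap.toMatrix_apply, hij]
      ring

/-- Along the segment from the identity no determinant vanishes, since a kernel vector would satisfy
`‖v‖ ≤ ‖A‖ ‖v‖`; so the sign stays that of `det id = 1`. -/
theorem det_id_add_pos_of_norm_lt_one {A : E →L[ℝ] E} (hA : ‖A‖ < 1) :
    0 < (ContinuousLinearMap.id ℝ E + A).det := by
  have hne : ∀ s ∈ Icc (0 : ℝ) 1, (ContinuousLinearMap.id ℝ E + s • A).det ≠ 0 := by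
    intro s hs h0
    obtain ⟨v, hv, hv0⟩ := LinearMap.bot_lt_ker_of_det_eq_zero h0 |>.ne' |> Submodule.exists_mem_ne_zero_of_ne_bot
    have hv1 : v + s • A v = 0 := by simpa using hv
    have h1 : ‖v‖ = s * ‖A v‖ := by
      rw [eq_neg_of_add_eq_zero_left hv1, norm_neg, norm_smul, Real.norm_of_nonneg hs.1,
        ← eq_neg_of_add_eq_zero_left hv1]
    have h2 := A.le_opNorm v
    have h3 : 0 < ‖v‖ := norm_pos_iff.2 hv0
    nlinarith [hs.1, hs.2, norm_nonneg (A v)]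
  have hc : Continuous fun s : ℝ => (ContinuousLinearMap.id ℝ E + s • A).det :=
    ContinuousLinearMap.continuous_det.comp (by fun_prop)
  by_contra! hneg
  have h0 : (ContinuousLinearMap.id ℝ E + (0 : ℝ) • A).det = 1 := by
    simp [ContinuousLinearMap.det]
  obtain ⟨s, hs, hs0⟩ := intermediate_value_Icc' zero_le_one hc.continuousOn
    (show (0 : ℝ) ∈ _ from ⟨by simpa using hneg, by rw [h0]; exact zero_le_one⟩)
  exact hne s hs hs0

variable [MeasurableSpace E] [BorelSpace E] (μ : Measure E) [μ.IsAddHaarMeasure]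

theorem setIntegral_comp_id_add_smul_mul_det_of_lipschitz {k : E → E} (hk : ContDiff ℝ 1 k)
    {K : NNReal} (hK : LipschitzWith K k) {r : ℝ} (hr : ∀ x, x ∉ ball (0 : E) r → k x = 0)
    {t : ℝ} (ht : 0 ≤ t) (htK : t * K < 1) (ψ : E → ℝ) :
    ∫ x in ball 0 r, (ContinuousLinearMap.id ℝ E + t • fderiv ℝ k x).det * ψ (x + t • k x) ∂μ =
      ∫ x in ball 0 r, ψ x ∂μ := by
  lift t to NNReal using ht
  have happ : ApproximatesLinearOn (fun x => x + t • k x)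
      ((ContinuousLinearEquiv.refl ℝ E : E ≃L[ℝ] E) : E →L[ℝ] E) univ (t * K) := by
    intro x _ y _
    have h : x + t • k x - (y + t • k y) - (x - y) = t • (k x - k y) := by
      rw [smul_sub]; abel
    simp only [ContinuousLinearEquiv.coe_coe, ContinuousLinearEquiv.coe_refl', id, h]
    rw [NNReal.smul_def, norm_smul, NNReal.norm_eq, NNReal.coe_mul, mul_assoc]
    exact mul_le_mul_of_nonneg_left (hK.norm_sub_le x y) t.2
  have hc : Subsingleton E ∨
      t * K < ‖((ContinuousLinearEquiv.refl ℝ E).symm : E →L[ℝ] E)‖₊⁻¹ := by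
    rcases subsingleton_or_nontrivial E with h | h
    · exact Or.inl h
    · right
      have : ((ContinuousLinearEquiv.refl ℝ E).symm : E →L[ℝ] E) = ContinuousLinearMap.id ℝ E := rfl
      rw [this, ContinuousLinearMap.nnnorm_id]
      simpa [← NNReal.coe_lt_coe] using htK
  have hinj := injOn_univ.1 (happ.injOn hc)
  have hsurj := happ.surjective hc
  -- A bijection of `E` that fixes every point outside the ball maps the ball onto itself.
  have himage : (fun x => x + t • k x) '' ball 0 r = ball 0 r := by
    have hfix : ∀ x, x ∉ ball (0 : E) r → x + t • k x = x := fun x hx => by simp [hr x hx]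
    ext y
    constructor
    · rintro ⟨x, hx, rfl⟩
      by_contra hy
      exact hy (by rwa [hinj (hfix _ hy)])
    · intro hy
      obtain ⟨x, rfl⟩ := hsurj y
      refine ⟨x, ?_, rfl⟩
      by_contra hx
      simp only [hfix x hx] at hy
      exact hx hy
  have hder : ∀ x ∈ ball (0 : E) r, HasFDerivWithinAt (fun x => x + t • k x)
      (ContinuousLinearMap.id ℝ E + (t : ℝ) • fderiv ℝ k x) (ball 0 r) x := fun x _ =>
    ((hasFDerivAt_id x).add
      ((hk.differentiable (by simp) x).hasFDerivAt.const_smul (t : ℝ))).hasFDerivWithinAt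
  have hcv := integral_image_eq_integral_abs_det_fderiv_smul μ measurableSet_ball hder
    hinj.injOn ψ
  rw [himage] at hcv
  rw [hcv]
  refine setIntegral_congr_fun measurableSet_ball fun x _ => ?_
  have hpos : 0 < (ContinuousLinearMap.id ℝ E + (t : ℝ) • fderiv ℝ k x).det := by
    refine det_id_add_pos_of_norm_lt_one ?_
    rw [norm_smul]
    refine lt_of_le_of_lt ?_ htK
    simp only [NNReal.norm_eq]
    exact mul_le_mul_of_nonneg_left (norm_fderiv_le_of_lipschitz ℝ hK) t.2
  simp [abs_of_pos hpos, NNReal.smul_def]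

/-- The change of variables formula for `x ↦ x + k x` with `k` of compact support, valid without
injectivity, for test functions which are polynomials in the squared norm. -/
theorem setIntegral_det_mul_pow_sub_normSq_comp {k : E → E} (hk : ContDiff ℝ 1 k) {r : ℝ}
    (hr : ∀ x, x ∉ ball (0 : E) r → k x = 0) (c : ℝ) (m : ℕ) :
    ∫ x in ball 0 r, (ContinuousLinearMap.id ℝ E + fderiv ℝ k x).det *
        (c - ‖x + k x‖ ^ 2) ^ m ∂μ =
      ∫ x in ball 0 r, (c - ‖x‖ ^ 2) ^ m ∂μ := by
  classical
  have hsupp : HasCompactSupport k :=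
    HasCompactSupport.intro (isCompact_closedBall (0 : E) r) fun x hx =>
      hr x fun h => hx (ball_subset_closedBall h)
  obtain ⟨K, hK⟩ := hk.lipschitzWith_of_hasCompactSupport hsupp (by simp)
  let F : ℝ → E → ℝ := fun t x =>
    (ContinuousLinearMap.id ℝ E + t • fderiv ℝ k x).det * (c - ‖x + t • k x‖ ^ 2) ^ m
  -- For fixed `x` the integrand is a polynomial in `t`: the determinant has degree at most
  -- `finrank`, the squared norm degree at most 2.
  let d := Module.finrank ℝ E + 2 * m
  have hpoly : ∀ x, ∃ p : ℝ[X], p.natDegree ≤ d ∧ ∀ t, p.eval t = F t x := by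
    intro x
    obtain ⟨p, hp, hpe⟩ := exists_polynomial_eval_eq_det_id_add_smul (fderiv ℝ k x)
    let q : ℝ[X] := C (c - ‖x‖ ^ 2) - C (2 * inner ℝ x (k x)) * X - C (‖k x‖ ^ 2) * X ^ 2
    have hq : q.natDegree ≤ 2 := by simp only [q]; compute_degree
    refine ⟨p * q ^ m, ?_, fun t => ?_⟩
    · refine natDegree_mul_le.trans (add_le_add hp ?_)
      refine natDegree_pow_le.trans ?_
      nlinarith
    · simp only [F, eval_mul, eval_pow, hpe, q, eval_sub, eval_C, eval_X]
      rw [norm_add_sq_real, norm_smul, inner_smul_right, Real.norm_eq_abs, mul_pow, sq_abs]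
      ring
  have hcont : ∀ t, Continuous (F t) := by
    intro t
    have h1 : Continuous (fderiv ℝ k) := hk.continuous_fderiv (by simp)
    have h2 : Continuous k := hk.continuous
    have h3 : Continuous fun x => (ContinuousLinearMap.id ℝ E + t • fderiv ℝ k x).det :=
      ContinuousLinearMap.continuous_det.comp (by fun_prop)
    simp only [F]
    fun_prop
  have hint : ∀ t, IntegrableOn (F t) (ball 0 r) μ := fun t =>
    ((hcont t).continuousOn.integrableOn_compact (isCompact_closedBall 0 r)).mono_set
      ball_subset_closedBall
  -- Distinct nodes with `v i * K < 1`, where the injective change of variables applies. Lagrange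
  -- interpolation at `d + 1` of them then reaches `t = 1`.
  let v : ℕ → ℝ := fun i => 1 / ((i + 1) * (K + 1))
  have hv : Function.Injective v := by
    intro i j hij
    have hK1 : (K : ℝ) + 1 ≠ 0 := by positivity
    have h1 : ((i : ℝ) + 1) * (K + 1) = (j + 1) * (K + 1) := by
      simpa [v, -mul_inv_rev, -mul_eq_mul_right_iff] using hij
    simpa using mul_right_cancel₀ hK1 h1
  have hvi : InjOn v (Finset.range (d + 1)) := hv.injOn
  have hsmall : ∀ i, ∫ x in ball 0 r, F (v i) x ∂μ = ∫ x in ball 0 r, (c - ‖x‖ ^ 2) ^ m ∂μ := by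
    intro i
    refine setIntegral_comp_id_add_smul_mul_det_of_lipschitz μ hk hK hr (t := v i)
      (by positivity) ?_ fun y => (c - ‖y‖ ^ 2) ^ m
    simp only [v]
    rw [div_mul_eq_mul_div, one_mul, div_lt_one (by positivity)]
    nlinarith [K.2, (Nat.cast_nonneg i : (0 : ℝ) ≤ i)]
  let ℓ : ℕ → ℝ := fun i => (Lagrange.basis (Finset.range (d + 1)) v i).eval 1
  have hexp : ∀ (p : ℝ[X]), p.natDegree ≤ d →
      p.eval 1 = ∑ i ∈ Finset.range (d + 1), p.eval (v i) * ℓ i := by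
    intro p hp
    have hdeg : p.degree < (Finset.range (d + 1)).card := by
      rw [Finset.card_range]
      exact lt_of_le_of_lt degree_le_natDegree (by exact_mod_cast Nat.lt_succ_of_le hp)
    conv_lhs => rw [Lagrange.eq_interpolate hvi hdeg]
    simp [Lagrange.interpolate_apply, eval_finsetSum, ℓ]
  have hF : ∀ x, F 1 x = ∑ i ∈ Finset.range (d + 1), F (v i) x * ℓ i := by
    intro x
    obtain ⟨p, hp, hpe⟩ := hpoly x
    simpa only [hpe] using hexp p hp
  have hone : ∑ i ∈ Finset.range (d + 1), ℓ i = 1 := by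
    have := hexp 1 (by simp)
    simpa using this.symm
  calc _ = ∫ x in ball 0 r, F 1 x ∂μ := by simp [F]
    _ = ∑ i ∈ Finset.range (d + 1), (∫ x in ball 0 r, F (v i) x ∂μ) * ℓ i := by
        simp only [hF]
        rw [integral_finsetSum _ fun i _ => (hint (v i)).mul_const _]
        simp only [integral_mul_const]
    _ = _ := by simp only [hsmall, ← Finset.mul_sum, hone, mul_one]


/-- A differentiable map of `E` whose derivative is everywhere singular is not uniformly close to
the identity on a ball. -/
theorem exists_one_half_lt_norm_sub_of_det_fderiv_eq_zero {g : E → E} (hg : ContDiff ℝ 1 g)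
    (hdet : ∀ x, (fderiv ℝ g x).det = 0) : ∃ x ∈ closedBall (0 : E) 2, 1 / 2 < ‖g x - x‖ := by
  by_contra! hclose
  borelize E
  let μ : Measure E := Measure.addHaar
  -- The cutoff makes `x + k x` equal to `g x` on the unit ball and to `x` outside the ball of
  -- radius 2.
  let φ : ContDiffBump (0 : E) := ⟨1, 2, one_pos, one_lt_two⟩
  let k : E → E := fun x => φ x • (g x - x)
  have hk : ContDiff ℝ 1 k := φ.contDiff.smul (hg.sub contDiff_id)
  have hk0 : ∀ x, x ∉ ball (0 : E) 2 → k x = 0 := by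
    intro x hx
    have : φ x = 0 := φ.zero_of_le_dist (by simpa using hx)
    simp [k, this]
  have hkn : ∀ x ∈ ball (0 : E) 2, ‖k x‖ ≤ 1 / 2 := by
    intro x hx
    rw [norm_smul, Real.norm_of_nonneg φ.nonneg]
    have := hclose x (ball_subset_closedBall hx)
    nlinarith [φ.nonneg (x := x), φ.le_one (x := x), norm_nonneg (g x - x)]
  have hdet0 : ∀ x ∈ ball (0 : E) 1, (ContinuousLinearMap.id ℝ E + fderiv ℝ k x).det = 0 := by
    intro x hx
    have hev : (fun y => y + k y) =ᶠ[𝓝 x] g := by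
      filter_upwards [isOpen_ball.mem_nhds hx] with y hy
      have : φ y = 1 := φ.one_of_mem_closedBall (ball_subset_closedBall hy)
      simp [k, this]
    have h1 : HasFDerivAt (fun y => y + k y) (ContinuousLinearMap.id ℝ E + fderiv ℝ k x) x :=
      (hasFDerivAt_id x).add (hk.differentiable (by simp) x).hasFDerivAt
    rw [← h1.fderiv, hev.fderiv_eq, hdet]
  obtain ⟨C, hC⟩ : ∃ C, ∀ x ∈ closedBall (0 : E) 2,
      ‖(ContinuousLinearMap.id ℝ E + fderiv ℝ k x).det‖ ≤ C := by
    have h1 : Continuous (fderiv ℝ k) := hk.continuous_fderiv (by simp)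
    exact (isCompact_closedBall (0 : E) 2).exists_bound_of_continuousOn
      (ContinuousLinearMap.continuous_det.comp (by fun_prop)).continuousOn
  have hC0 : 0 ≤ C := (norm_nonneg _).trans (hC 0 (by simp))
  -- The integrand vanishes on the unit ball; on the rest of the big ball `1/2 ≤ ‖x + k x‖ < 5/2`,
  -- so the power is at most `a ^ m`. On the ball of radius `1/4` the right-hand integrand is at
  -- least `b ^ m`. Since `a < b`, large `m` gives a contradiction.
  let a : ℝ := 9 - 1 / 4
  let b : ℝ := 9 - 1 / 16
  have hupper : ∀ m : ℕ, ∫ x in ball 0 2, (9 - ‖x‖ ^ 2) ^ m ∂μ ≤ C * a ^ m * μ.real (ball 0 2) := by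
    intro m
    rw [← setIntegral_det_mul_pow_sub_normSq_comp μ hk hk0 9 m]
    refine (le_abs_self _).trans ?_
    rw [← Real.norm_eq_abs]
    refine norm_setIntegral_le_of_norm_le_const measure_ball_lt_top fun x hx => ?_
    by_cases hx1 : x ∈ ball (0 : E) 1
    · rw [hdet0 x hx1, zero_mul, norm_zero]
      positivity
    · rw [norm_mul]
      refine mul_le_mul (hC x (ball_subset_closedBall hx)) ?_ (norm_nonneg _) hC0
      have h1 := hkn x hx
      have h2 : ‖x‖ < 2 := by simpa using hx
      have h3 : 1 ≤ ‖x‖ := by simpa using hx1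
      have h4 := norm_add_le x (k x)
      have h5 := norm_sub_le (x + k x) (k x)
      rw [add_sub_cancel_right] at h5
      rw [norm_pow]
      refine pow_le_pow_left₀ (norm_nonneg _) ?_ m
      rw [Real.norm_eq_abs, abs_le]
      constructor <;> simp only [a] <;> nlinarith [norm_nonneg (x + k x)]
  have hlower : ∀ m : ℕ, b ^ m * μ.real (ball 0 (1 / 4)) ≤
      ∫ x in ball 0 2, (9 - ‖x‖ ^ 2) ^ m ∂μ := by
    intro m
    have hint : IntegrableOn (fun x : E => (9 - ‖x‖ ^ 2) ^ m) (ball 0 2) μ :=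
      ((by fun_prop : Continuous fun x : E => (9 - ‖x‖ ^ 2) ^ m).continuousOn.integrableOn_compact
        (isCompact_closedBall 0 2)).mono_set ball_subset_closedBall
    have hsub : ball (0 : E) (1 / 4) ⊆ ball 0 2 := ball_subset_ball (by norm_num)
    calc b ^ m * μ.real (ball 0 (1 / 4)) = ∫ x in ball (0 : E) (1 / 4), b ^ m ∂μ := by
          rw [setIntegral_const, smul_eq_mul, mul_comm]
      _ ≤ ∫ x in ball (0 : E) (1 / 4), (9 - ‖x‖ ^ 2) ^ m ∂μ := by
          refine setIntegral_mono_on (integrableOn_const measure_ball_lt_top.ne)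
            (hint.mono_set hsub) measurableSet_ball fun x hx => ?_
          have h2 : ‖x‖ < 1 / 4 := by simpa using hx
          refine pow_le_pow_left₀ (by norm_num [b]) ?_ m
          simp only [b]
          nlinarith [norm_nonneg x]
      _ ≤ _ := by
          refine setIntegral_mono_set hint ?_ hsub.eventuallyLE
          refine (ae_restrict_iff' measurableSet_ball).2 (Eventually.of_forall fun x hx => ?_)
          have h2 : ‖x‖ < 2 := by simpa using hx
          exact pow_nonneg (by nlinarith [norm_nonneg x]) m
  have hpos : 0 < μ.real (ball (0 : E) (1 / 4)) :=
    ENNReal.toReal_pos (measure_ball_pos μ 0 (by norm_num)).ne' measure_ball_lt_top.ne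
  have hlim : Tendsto (fun m : ℕ => (a / b) ^ m * (C * μ.real (ball 0 2))) atTop (𝓝 0) := by
    simpa using (tendsto_pow_atTop_nhds_zero_of_lt_one (by norm_num [a, b])
      (by norm_num [a, b])).mul_const (C * μ.real (ball (0 : E) 2))
  obtain ⟨m, hm⟩ := (hlim.eventually_lt_const hpos).exists
  have h := (hlower m).trans (hupper m)
  have hb : 0 < b ^ m := by norm_num [b]
  rw [div_pow, div_mul_eq_mul_div, div_lt_iff₀ hb] at hm
  nlinarith

/-- Continuous injections do not lower the dimension. -/
theorem not_injOn_of_finrank_lt {F : Type*} [NormedAddCommGroup F] [NormedSpace ℝ F]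
    [FiniteDimensional ℝ F] (hdim : Module.finrank ℝ F < Module.finrank ℝ E) {f : E → F}
    {U : Set E} (hU : IsOpen U) (hne : U.Nonempty) (hf : ContinuousOn f U) : ¬ InjOn f U := by
  intro hinj
  obtain ⟨x₀, hx₀⟩ := hne
  obtain ⟨δ, hδ, hball⟩ := Metric.nhds_basis_closedBall.mem_iff.1 (hU.mem_nhds hx₀)
  let B := closedBall (0 : E) 2
  let s : E → E := fun x => x₀ + (δ / 2) • x
  have hs : MapsTo s B U := by
    intro x hx
    refine hball ?_
    have : ‖x‖ ≤ 2 := by simpa [B] using hx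
    simp only [s, mem_closedBall, dist_self_add_left, norm_smul, Real.norm_eq_abs,
      abs_of_pos (half_pos hδ)]
    nlinarith
  have hsinj : Function.Injective s := fun x y h =>
    smul_right_injective E (half_pos hδ).ne' (add_left_cancel h)
  let e : B → F := fun x => f (s x)
  have he : Continuous e := by
    have : ContinuousOn (f ∘ s) B := hf.comp (by fun_prop) hs
    exact continuousOn_iff_continuous_domRestrict.1 this
  have heinj : Function.Injective e := fun x y h =>
    Subtype.ext (hsinj (hinj (hs x.2) (hs y.2) h))
  have : CompactSpace B := isCompact_iff_compactSpace.1 (isCompact_closedBall 0 2)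
  have : TietzeExtension E := RCLike.instTietzeExtensionTVS (𝕜 := ℝ)
  have : TietzeExtension F := RCLike.instTietzeExtensionTVS (𝕜 := ℝ)
  -- By compactness `e` is a closed embedding, so Tietze extends its inverse to all of `F`.
  obtain ⟨G, hG⟩ := ContinuousMap.exists_extension (he.isClosedEmbedding heinj)
    (⟨Subtype.val, continuous_subtype_val⟩ : C(B, E))
  obtain ⟨H, hH⟩ := ContinuousMap.exists_restrict_eq (isClosed_closedBall (x := (0 : E)) (ε := 2))
    ⟨e, he⟩
  have hGH : ∀ x ∈ B, G (H x) = x := by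
    intro x hx
    have h1 : H x = e ⟨x, hx⟩ := DFunLike.congr_fun hH ⟨x, hx⟩
    rw [h1]
    exact DFunLike.congr_fun hG ⟨x, hx⟩
  -- In the compact-open topology, closeness of the composite to the identity on `B` is an open
  -- condition, so smooth pairs satisfy it.
  have hopen : IsOpen {p : C(E, F) × C(F, E) |
      MapsTo (p.2.comp p.1 - ContinuousMap.id E) B (ball 0 (1 / 2))} :=
    (ContinuousMap.isOpen_setOfPred_mapsTo (isCompact_closedBall 0 2) isOpen_ball).preimage
      ((continuous_snd.compCM continuous_fst).sub continuous_const)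
  have hmem : (H, G) ∈ {p : C(E, F) × C(F, E) |
      MapsTo (p.2.comp p.1 - ContinuousMap.id E) B (ball 0 (1 / 2))} := by
    intro x hx
    simp [hGH x hx]
  obtain ⟨⟨Q, P⟩, hQP, hQ, hP⟩ := ((ContinuousMap.dense_setOfPred_contDiff (E := E) (F := F)).prod
    (ContinuousMap.dense_setOfPred_contDiff (E := F) (F := E))).inter_open_nonempty _ hopen
      ⟨_, hmem⟩
  rw [mem_ofPred_eq] at hQ hP
  have hQ1 : ContDiff ℝ 1 Q := ContDiff.of_le (f := Q) hQ (by exact_mod_cast le_top)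
  have hP1 : ContDiff ℝ 1 P := ContDiff.of_le (f := P) hP (by exact_mod_cast le_top)
  obtain ⟨x, hx, hlt⟩ := exists_one_half_lt_norm_sub_of_det_fderiv_eq_zero (hP1.comp hQ1)
    fun x => by
      rw [fderiv_comp x (hP1.differentiable (by simp) _) (hQ1.differentiable (by simp) _)]
      refine LinearMap.det_eq_zero_iff_ker_ne_bot.2 fun hker => ?_
      refine LinearMap.ker_ne_bot_of_finrank_lt
        (f := (fderiv ℝ Q x : E →ₗ[ℝ] F)) hdim (le_bot_iff.1 ?_)
      rw [← hker]
      exact LinearMap.ker_le_ker_comp _ _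
  have := hQP hx
  simp only [mem_ball, dist_zero_right] at this
  exact absurd hlt (not_lt.2 this.le)

end Degree

namespace TwiceDifferentiableOn

variable {D : ℕ} {Θ : Set (ParamSpace D)} {f g : ParamSpace D → ℝ}

theorem differentiableOn (hf : TwiceDifferentiableOn f Θ) : DifferentiableOn ℝ f Θ := by
  obtain ⟨f', hf', -⟩ := hf
  exact fun θ hθ => (hf' θ hθ).differentiableWithinAt

theorem congr (hf : TwiceDifferentiableOn f Θ) (h : Set.EqOn g f Θ) :
    TwiceDifferentiableOn g Θ := by
  obtain ⟨f', hf', hf''⟩ := hf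
  exact ⟨f', fun θ hθ => (hf' θ hθ).congr h (h hθ), hf''⟩

theorem const (a : ℝ) : TwiceDifferentiableOn (fun _ => a) Θ :=
  ⟨fun _ => 0, fun θ _ => hasFDerivWithinAt_const a θ Θ, differentiableOn_const 0⟩

theorem mul (hf : TwiceDifferentiableOn f Θ) (hg : TwiceDifferentiableOn g Θ) :
    TwiceDifferentiableOn (fun θ => f θ * g θ) Θ := by
  have hfd := hf.differentiableOn
  have hgd := hg.differentiableOn
  obtain ⟨f', hf', hf''⟩ := hf
  obtain ⟨g', hg', hg''⟩ := hg
  exact ⟨fun θ => f θ • g' θ + g θ • f' θ, fun θ hθ => (hf' θ hθ).mul (hg' θ hθ),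
    (hfd.smul hg'').add (hgd.smul hf'')⟩

theorem finsetProd {ι : Type*} (s : Finset ι) {f : ι → ParamSpace D → ℝ}
    (hf : ∀ i ∈ s, TwiceDifferentiableOn (f i) Θ) :
    TwiceDifferentiableOn (fun θ => ∏ i ∈ s, f i θ) Θ := by
  classical
  induction s using Finset.induction_on with
  | empty => simpa using const 1
  | insert i s hi ih =>
    simp only [Finset.prod_insert hi]
    exact (hf i (by simp)).mul (ih fun j hj => hf j (by simp [hj]))

end TwiceDifferentiableOn

/-! ### Singular matrices and the information identity -/

section Matrix

variable {D : ℕ}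

theorem det_eq_zero_of_apply_eq_sum {α : Type*} [Fintype α] {M : Matrix (Fin D) (Fin D) ℝ}
    (b : α → Fin D → ℝ) (φ : α → ParamSpace D →L[ℝ] ℝ)
    (hM : ∀ l m, M l m = ∑ a, b a l * φ a (EuclideanSpace.single m 1))
    {v : ParamSpace D} (hv : v ≠ 0) (hφ : ∀ a, φ a v = 0) : M.det = 0 := by
  refine Matrix.exists_mulVec_eq_zero_iff.1 ⟨fun m => v m, fun h => hv ?_, ?_⟩
  · ext m
    exact congrFun h m
  · ext l
    have hexp : v = ∑ m, v m • EuclideanSpace.single m (1 : ℝ) := by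
      ext i
      simp [Finset.sum_apply, Pi.single_apply]
    have hφ' : ∀ a, ∑ m, φ a (EuclideanSpace.single m 1) * v m = 0 := by
      intro a
      have h := hφ a
      rw [hexp, map_sum] at h
      simpa [mul_comm] using h
    simp only [Matrix.mulVec, dotProduct, hM, Finset.sum_mul, Pi.zero_apply]
    rw [Finset.sum_comm]
    refine Finset.sum_eq_zero fun a _ => ?_
    simp only [mul_assoc, ← Finset.mul_sum, hφ' a, mul_zero]

/-- For a finite family of probabilities summing to one, the expected negative Hessian of the
logarithms is the Fisher information. -/
theorem neg_sum_mul_partialWithin_log_eq {Θ : Set (ParamSpace D)} {ι : Type*} [Fintype ι]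
    {f : ι → ParamSpace D → ℝ} (hf : ∀ u, TwiceDifferentiableOn (f u) Θ)
    (hsum : ∀ θ ∈ Θ, ∑ u, f u θ = 1) {θ : ParamSpace D} (hθ : θ ∈ Θ)
    (hunique : ∀ᶠ η in 𝓝[Θ] θ, UniqueDiffWithinAt ℝ Θ η)
    (hsupp : ∀ u, f u θ ≠ 0 ∨ ∀ᶠ η in 𝓝[Θ] θ, f u η = 0) (l m : Fin D) :
    -∑ u, f u θ * partialWithin Θ l (partialWithin Θ m fun η => Real.log (f u η)) θ =
      ∑ u, 1 / f u θ * (partialWithin Θ l (f u) θ * partialWithin Θ m (f u) θ) := by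
  classical
  have hdiff : ∀ u, DifferentiableOn ℝ (f u) Θ := fun u => (hf u).differentiableOn
  choose f' hf' hf'' using hf
  have hUθ : UniqueDiffWithinAt ℝ Θ θ := hunique.self_of_nhdsWithin hθ
  have hmem : ∀ᶠ η in 𝓝[Θ] θ, η ∈ Θ := self_mem_nhdsWithin
  -- The support is frozen at `θ`. By `hsupp` the remaining terms vanish nearby, so the sum over `S`
  -- is locally constant and its first and second derivatives are zero.
  let S : Finset ι := Finset.univ.filter fun u => f u θ ≠ 0
  have hS : ∀ᶠ η in 𝓝[Θ] θ, ∑ u ∈ S, f u η = 1 := by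
    have h0 : ∀ᶠ η in 𝓝[Θ] θ, ∀ u, u ∉ S → f u η = 0 := by
      refine eventually_all.2 fun u => ?_
      by_cases hu : u ∈ S
      · exact Eventually.of_forall fun η h => absurd hu h
      · rcases hsupp u with h | h
        · exact absurd (by simp [S, h]) hu
        · exact h.mono fun η hη _ => hη
    filter_upwards [h0, hmem] with η h0 hη
    rw [← hsum η hη]
    exact Finset.sum_subset (Finset.subset_univ S) fun u _ hu => h0 u hu
  let e : Fin D → ParamSpace D := fun l => EuclideanSpace.single l 1
  let d : ι → ParamSpace D → ℝ := fun u η => f' u η (e m)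
  have hd : ∀ u, HasFDerivWithinAt (d u)
      ((ContinuousLinearMap.apply ℝ ℝ (e m)).comp (fderivWithin ℝ (f' u) Θ θ)) Θ θ := fun u =>
    (ContinuousLinearMap.apply ℝ ℝ (e m)).hasFDerivAt.comp_hasFDerivWithinAt θ
      (hf'' u θ hθ).hasFDerivWithinAt
  have hdS : ∀ᶠ η in 𝓝[Θ] θ, ∑ u ∈ S, d u η = 0 := by
    filter_upwards [eventually_eventually_nhdsWithin.2 hS, hunique, hmem] with η hη hUη hηΘ
    have h1 : HasFDerivWithinAt (fun ζ => ∑ u ∈ S, f u ζ) (∑ u ∈ S, f' u η) Θ η :=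
      HasFDerivWithinAt.fun_sum fun u _ => hf' u η hηΘ
    have h2 : HasFDerivWithinAt (fun ζ => ∑ u ∈ S, f u ζ) (0 : ParamSpace D →L[ℝ] ℝ) Θ η :=
      (hasFDerivWithinAt_const (1 : ℝ) η Θ).congr_of_eventuallyEq hη
        (hη.self_of_nhdsWithin hηΘ)
    have h3 := hUη.eq h1 h2
    have h4 := DFunLike.congr_fun h3 (e m)
    simpa [d] using h4
  have hsecond : ∑ u ∈ S, fderivWithin ℝ (f' u) Θ θ (e l) (e m) = 0 := by
    have h1 : HasFDerivWithinAt (fun ζ => ∑ u ∈ S, d u ζ) _ Θ θ :=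
      HasFDerivWithinAt.fun_sum fun u _ => hd u
    have h2 : HasFDerivWithinAt (fun ζ => ∑ u ∈ S, d u ζ) (0 : ParamSpace D →L[ℝ] ℝ) Θ θ :=
      (hasFDerivWithinAt_const (0 : ℝ) θ Θ).congr_of_eventuallyEq hdS
        (hdS.self_of_nhdsWithin hθ)
    have h4 := DFunLike.congr_fun (hUθ.eq h1 h2) (e l)
    simpa using h4
  have hpartial : ∀ u l, partialWithin Θ l (f u) θ = f' u θ (e l) := fun u l => by
    rw [partialWithin, (hf' u θ hθ).fderivWithin hUθ]
  have hlog : ∀ u ∈ S, f u θ * partialWithin Θ l (partialWithin Θ m fun η => Real.log (f u η)) θ =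
      fderivWithin ℝ (f' u) Θ θ (e l) (e m) - 1 / f u θ * (f' u θ (e l) * f' u θ (e m)) := by
    intro u hu
    have hu0 : f u θ ≠ 0 := by simpa [S] using hu
    have hne : ∀ᶠ η in 𝓝[Θ] θ, f u η ≠ 0 :=
      (hdiff u).continuousOn.continuousWithinAt hθ |>.eventually_ne hu0
    have heq : (partialWithin Θ m fun η => Real.log (f u η)) =ᶠ[𝓝[Θ] θ]
        fun η => (f u η)⁻¹ * d u η := by
      filter_upwards [hne, hunique, hmem] with η hη hUη hηΘ
      rw [partialWithin, ((hf' u η hηΘ).log hη).fderivWithin hUη]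
      simp [d, e]
    have hinv : HasFDerivWithinAt (fun η => (f u η)⁻¹) (-(f u θ ^ 2)⁻¹ • f' u θ) Θ θ :=
      (hasDerivAt_inv hu0).comp_hasFDerivWithinAt θ (hf' u θ hθ)
    rw [partialWithin, heq.fderivWithin_eq (heq.self_of_nhdsWithin hθ),
      (hinv.fun_mul (hd u)).fderivWithin hUθ]
    simp only [add_apply, smul_apply, smul_eq_mul,
      ContinuousLinearMap.comp_apply, ContinuousLinearMap.apply_apply, d]
    change _ * (_ * fderivWithin ℝ (f' u) Θ θ (e l) (e m) + _ * (_ * f' u θ (e l))) = _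
    field_simp
    ring
  have hleft : ∑ u, f u θ * partialWithin Θ l (partialWithin Θ m fun η => Real.log (f u η)) θ =
      ∑ u ∈ S, f u θ * partialWithin Θ l (partialWithin Θ m fun η => Real.log (f u η)) θ := by
    refine (Finset.sum_subset (Finset.subset_univ S) fun u _ hu => ?_).symm
    rw [show f u θ = 0 by simpa [S] using hu, zero_mul]
  have hright : ∑ u, 1 / f u θ * (partialWithin Θ l (f u) θ * partialWithin Θ m (f u) θ) =
      ∑ u ∈ S, 1 / f u θ * (f' u θ (e l) * f' u θ (e m)) := by
    simp only [hpartial]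
    refine (Finset.sum_subset (Finset.subset_univ S) fun u _ hu => ?_).symm
    rw [show f u θ = 0 by simpa [S] using hu, div_zero, zero_mul]
  rw [hleft, hright, Finset.sum_congr rfl hlog, Finset.sum_sub_distrib, hsecond, zero_sub, neg_neg]

end Matrix

section Cells

/-! A finite family of probability vectors depending on a parameter, with fewer degrees of
freedom than parameters. -/

variable {D : ℕ} {Θ : Set (ParamSpace D)} {κ : Type*} [Fintype κ] {ρ : κ → Type*}
  [∀ k, Fintype (ρ k)] [∀ k, Nonempty (ρ k)] {c : ∀ k, ρ k → ParamSpace D → ℝ}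

theorem exists_card_sigma_ne_lt (hD : ∑ k, ((Fintype.card (ρ k) : ℤ) - 1) < D) :
    ∃ r₀ : ∀ k, ρ k, Nat.card (Σ k, {r : ρ k // r ≠ r₀ k}) < D := by
  classical
  refine ⟨fun k => Classical.arbitrary _, ?_⟩
  rw [Nat.card_eq_fintype_card, Fintype.card_sigma]
  zify
  convert hD using 2 with k
  rw [Fintype.card_subtype_compl, Fintype.card_subtype_eq, Nat.cast_sub Fintype.card_pos,
    Nat.cast_one]

/-- Restores the cell dropped from each group, both for probabilities and for their derivatives. -/
theorem sum_eq_sum_of_forall_ne {α M : Type*} [Fintype α] [AddCommGroup M] {f g : α → M}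
    (hsum : ∑ a, f a = ∑ a, g a) {a₀ : α} (h : ∀ a ≠ a₀, f a = g a) : f = g := by
  classical
  funext a
  by_cases ha : a = a₀
  · subst ha
    rw [← Finset.add_sum_erase _ f (Finset.mem_univ a),
      ← Finset.add_sum_erase _ g (Finset.mem_univ a),
      Finset.sum_congr rfl fun b hb => h b (Finset.ne_of_mem_erase hb)] at hsum
    exact add_right_cancel hsum
  · exact h a ha

theorem exists_ne_zero_forall_fderivWithin_apply_eq_zero
    (hD : ∑ k, ((Fintype.card (ρ k) : ℤ) - 1) < D)
    (hsum : ∀ θ ∈ Θ, ∀ k, ∑ r, c k r θ = 1) (hc : ∀ k r, DifferentiableOn ℝ (c k r) Θ)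
    {θ : ParamSpace D} (hθ : θ ∈ Θ) (hU : UniqueDiffWithinAt ℝ Θ θ) :
    ∃ v : ParamSpace D, v ≠ 0 ∧ ∀ k r, fderivWithin ℝ (c k r) Θ θ v = 0 := by
  obtain ⟨r₀, hr₀⟩ := exists_card_sigma_ne_lt hD
  have := Fintype.ofFinite (Σ k, {r : ρ k // r ≠ r₀ k})
  let A : ParamSpace D →ₗ[ℝ] ((Σ k, {r : ρ k // r ≠ r₀ k}) → ℝ) :=
    LinearMap.pi fun a => (fderivWithin ℝ (c a.1 a.2) Θ θ : ParamSpace D →ₗ[ℝ] ℝ)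
  have hker : A.ker ≠ ⊥ := LinearMap.ker_ne_bot_of_finrank_lt (by
    rw [Module.finrank_pi, finrank_euclideanSpace_fin, ← Nat.card_eq_fintype_card]
    exact hr₀)
  obtain ⟨v, hv, hv0⟩ := Submodule.exists_mem_ne_zero_of_ne_bot hker
  refine ⟨v, hv0, fun k => ?_⟩
  have hne : ∀ r ≠ r₀ k, fderivWithin ℝ (c k r) Θ θ v = 0 := fun r hr =>
    congrFun (LinearMap.mem_ker.1 hv) ⟨k, r, hr⟩
  have h1 : HasFDerivWithinAt (fun η => ∑ r, c k r η) (∑ r, fderivWithin ℝ (c k r) Θ θ) Θ θ :=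
    HasFDerivWithinAt.fun_sum fun r _ => (hc k r θ hθ).hasFDerivWithinAt
  have h2 : HasFDerivWithinAt (fun η => ∑ r, c k r η) (0 : ParamSpace D →L[ℝ] ℝ) Θ θ :=
    (hasFDerivWithinAt_const (1 : ℝ) θ Θ).congr (fun η hη => hsum η hη k) (hsum θ hθ k)
  have h3 : ∑ r, fderivWithin ℝ (c k r) Θ θ v = 0 := by
    have := DFunLike.congr_fun (hU.eq h1 h2) v
    simpa using this
  exact fun r => congrFun (sum_eq_sum_of_forall_ne (g := fun _ => (0 : ℝ)) (by simpa using h3) hne) r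

theorem exists_ne_forall_eq_of_continuousOn (hD : ∑ k, ((Fintype.card (ρ k) : ℤ) - 1) < D)
    (hsum : ∀ θ ∈ Θ, ∀ k, ∑ r, c k r θ = 1) (hc : ∀ k r, ContinuousOn (c k r) Θ)
    {U : Set (ParamSpace D)} (hU : IsOpen U) (hne : U.Nonempty) (hUΘ : U ⊆ Θ) :
    ∃ θ ∈ U, ∃ θ' ∈ U, θ ≠ θ' ∧ ∀ k r, c k r θ = c k r θ' := by
  obtain ⟨r₀, hr₀⟩ := exists_card_sigma_ne_lt hD
  have := Fintype.ofFinite (Σ k, {r : ρ k // r ≠ r₀ k})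
  have hninj : ¬ Set.InjOn
      (fun θ (a : Σ k, {r : ρ k // r ≠ r₀ k}) => c a.1 a.2 θ) U := by
    refine not_injOn_of_finrank_lt ?_ hU hne ?_
    · rw [Module.finrank_pi, finrank_euclideanSpace_fin, ← Nat.card_eq_fintype_card]
      exact hr₀
    · exact continuousOn_pi.2 fun a => (hc _ _).mono hUΘ
  simp only [Set.InjOn, not_forall] at hninj
  obtain ⟨θ, hθ, θ', hθ', heq, hθne⟩ := hninj
  refine ⟨θ, hθ, θ', hθ', hθne, fun k r => ?_⟩
  refine congrFun (sum_eq_sum_of_forall_ne (f := fun r => c k r θ) (g := fun r => c k r θ')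
    (a₀ := r₀ k) ?_ fun r hr => ?_) r
  · rw [hsum θ (hUΘ hθ), hsum θ' (hUΘ hθ')]
  · exact congrFun heq ⟨k, r, hr⟩

theorem fderivWithin_apply_eq_zero_of_eqOn_prod {ι : Type*} [Fintype ι]
    {f : ParamSpace D → ℝ} {h : ι → ParamSpace D → ℝ} (hf : ∀ θ ∈ Θ, f θ = ∏ i, h i θ)
    (hh : ∀ i, DifferentiableOn ℝ (h i) Θ) {θ : ParamSpace D} (hθ : θ ∈ Θ)
    (hU : UniqueDiffWithinAt ℝ Θ θ) {v : ParamSpace D}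
    (hv : ∀ i, fderivWithin ℝ (h i) Θ θ v = 0) : fderivWithin ℝ f Θ θ v = 0 := by
  classical
  rw [fderivWithin_congr hf (hf θ hθ), fderivWithin_finsetProd hU fun i _ => hh i θ hθ]
  simp [hv]

end Cells

namespace VectorQuantizer

variable {X : Type*} [MeasurableSpace X] {R : ℕ}

theorem nonempty_fin [Nonempty X] (γ : VectorQuantizer X R) : Nonempty (Fin R) := by
  obtain ⟨x⟩ := ‹Nonempty X›
  obtain ⟨r, -⟩ := Set.mem_iUnion.1 (γ.cover ▸ Set.mem_univ x : x ∈ ⋃ r, γ.region r)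
  exact ⟨r⟩

theorem sum_measureReal_region (γ : VectorQuantizer X R) (ν : Measure X)
    [IsProbabilityMeasure ν] : ∑ r, ν.real (γ.region r) = 1 := by
  rw [← measureReal_iUnion_fintype γ.disjoint_region γ.measurableSet_region, γ.cover,
    probReal_univ]

theorem measureReal_forall_output_eq {Ω ι : Type*} [MeasurableSpace Ω] [Fintype ι]
    {Y : ι → Type*} [∀ i, MeasurableSpace (Y i)] {S : ι → ℕ} {μ : Measure Ω}
    {x : ∀ i, Ω → Y i} (hx : ∀ i, Measurable (x i)) (hindep : iIndepFun x μ)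
    (γ : ∀ i, VectorQuantizer (Y i) (S i)) (u : ∀ i, Fin (S i)) :
    μ.real {ω | ∀ i, (γ i).output (x i ω) = (u i : ℕ) + 1} =
      ∏ i, (μ.map (x i)).real ((γ i).region (u i)) := by
  have hset : {ω | ∀ i, (γ i).output (x i ω) = (u i : ℕ) + 1} =
      ⋂ i, x i ⁻¹' (γ i).region (u i) := by
    ext ω
    simp [output_eq_iff]
  rw [hset, measureReal_def, hindep.meas_iInter fun i =>
    ⟨_, (γ i).measurableSet_region (u i), rfl⟩, ENNReal.toReal_prod]
  refine Finset.prod_congr rfl fun i _ => ?_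
  rw [measureReal_def, Measure.map_apply (hx i) ((γ i).measurableSet_region _)]

end VectorQuantizer

/-- Marginalization: with coordinate `i` pinned to `r`, the sum of products factors and every other
factor is 1. -/
theorem eq_sum_piFinset_prod {ι : Type*} [Fintype ι] [DecidableEq ι] {ρ : ι → Type*}
    [∀ i, Fintype (ρ i)] [∀ i, DecidableEq (ρ i)] (a : ∀ i, ρ i → ℝ) (ha : ∀ i, ∑ r, a i r = 1)
    (i : ι) (r : ρ i) :
    a i r = ∑ s ∈ Fintype.piFinset
      (Function.update (fun i => (Finset.univ : Finset (ρ i))) i {r}), ∏ j, a j (s j) := by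
  rw [← Finset.prod_univ_sum, Finset.prod_eq_single i]
  · simp
  · intro j _ hj
    rw [Function.update_of_ne hj, ha]
  · simp

/-! ### Quantized systems in terms of cell probabilities -/

section System

variable {D N : ℕ} {L : Fin N → ℕ} {Θ : Set (ParamSpace D)} {κ : Type*}
  {g : SubvectorIndex L → κ} {X : κ → Type*} [∀ k, MeasurableSpace (X k)]
  {Pmodel : ∀ k, ParamSpace D → Measure (X k)} {R : κ → ℕ} {γ : ∀ k, VectorQuantizer (X k) (R k)}
  {Ω : Type*} [MeasurableSpace Ω] {P : ParamSpace D → Measure Ω} {x : ∀ i, Ω → X (g i)}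

/-- The probability, in the model of the group `k`, of the region with index `r` of its
quantizer. -/
def cellProb (Pmodel : ∀ k, ParamSpace D → Measure (X k)) (γ : ∀ k, VectorQuantizer (X k) (R k))
    (k : κ) (r : Fin (R k)) (θ : ParamSpace D) : ℝ :=
  (Pmodel k θ).real ((γ k).region r)

theorem dataProb_eq_prod_cellProb (hx : ∀ i, Measurable (x i))
    {θ : ParamSpace D} (hindep : iIndepFun x (P θ))
    (hident : ∀ i, (P θ).map (x i) = Pmodel (g i) θ) (u : ∀ i, Fin (R (g i))) :
    dataProb P x (fun i => γ (g i)) u θ = ∏ i, cellProb Pmodel γ (g i) (u i) θ := by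
  rw [dataProb, VectorQuantizer.measureReal_forall_output_eq hx hindep]
  simp only [hident, cellProb]

theorem outcomeProb_eq_prod_cellProb (hx : ∀ i, Measurable (x i))
    {θ : ParamSpace D} (hindep : iIndepFun x (P θ))
    (hident : ∀ i, (P θ).map (x i) = Pmodel (g i) θ) (j : Fin N)
    (s : ∀ l : Fin (L j), Fin (R (g ⟨j, l⟩))) :
    outcomeProb P x (fun i => γ (g i)) j s θ =
      ∏ l, cellProb Pmodel γ (g ⟨j, l⟩) (s l) θ := by
  have hj : iIndepFun (fun l : Fin (L j) => x ⟨j, l⟩) (P θ) :=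
    hindep.precomp (g := fun l : Fin (L j) => (⟨j, l⟩ : SubvectorIndex L))
      fun l l' h => by simpa using h
  rw [outcomeProb, VectorQuantizer.measureReal_forall_output_eq (fun l => hx ⟨j, l⟩) hj]
  simp only [hident, cellProb]

variable (hg : Function.Surjective g) (hP : ∀ θ ∈ Θ, IsProbabilityMeasure (P θ))
  (hx : ∀ i, Measurable (x i)) (hindep : ∀ θ ∈ Θ, iIndepFun x (P θ))
  (hident : ∀ θ ∈ Θ, ∀ i, (P θ).map (x i) = Pmodel (g i) θ)

include hg hP hx hident in
theorem sum_cellProb_eq_one : ∀ θ ∈ Θ, ∀ k, ∑ r, cellProb Pmodel γ k r θ = 1 := by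
  intro θ hθ k
  obtain ⟨i, rfl⟩ := hg k
  have := hP θ hθ
  have : IsProbabilityMeasure (Pmodel (g i) θ) :=
    hident θ hθ i ▸ Measure.isProbabilityMeasure_map (hx i).aemeasurable
  exact (γ (g i)).sum_measureReal_region _

include hg hP hx hindep hident in
-- Regularity is assumed only for the sensor outcome probabilities. A cell probability is a marginal
-- of one sensor containing a member of the group, so it inherits that regularity.
theorem exists_cellProb_eq_sum_outcomeProb (k : κ) (r : Fin (R k)) :
    ∃ (j : Fin N) (t : Finset (∀ l : Fin (L j), Fin (R (g ⟨j, l⟩)))), ∀ θ ∈ Θ,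
      cellProb Pmodel γ k r θ = ∑ s ∈ t, outcomeProb P x (fun i => γ (g i)) j s θ := by
  classical
  obtain ⟨⟨j, l⟩, rfl⟩ := hg k
  refine ⟨j, Fintype.piFinset (Function.update (fun _ => Finset.univ) l {r}), fun θ hθ => ?_⟩
  simp only [outcomeProb_eq_prod_cellProb hx (hindep θ hθ) (hident θ hθ)]
  exact eq_sum_piFinset_prod (fun l r => cellProb Pmodel γ (g ⟨j, l⟩) r θ)
    (fun l => sum_cellProb_eq_one hg hP hx hident θ hθ _) l r

include hg hP hx hindep hident in
theorem continuousOn_cellProb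
    (hq : ∀ j s, ContinuousOn (outcomeProb P x (fun i => γ (g i)) j s) Θ)
    (k : κ) (r : Fin (R k)) : ContinuousOn (cellProb Pmodel γ k r) Θ := by
  obtain ⟨j, t, h⟩ := exists_cellProb_eq_sum_outcomeProb (γ := γ) hg hP hx hindep hident k r
  exact (continuousOn_finsetSum t fun s _ => hq j s).congr h

include hg hP hx hindep hident in
theorem differentiableOn_cellProb
    (hq : ∀ j s, DifferentiableOn ℝ (outcomeProb P x (fun i => γ (g i)) j s) Θ)
    (k : κ) (r : Fin (R k)) : DifferentiableOn ℝ (cellProb Pmodel γ k r) Θ := by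
  obtain ⟨j, t, h⟩ := exists_cellProb_eq_sum_outcomeProb (γ := γ) hg hP hx hindep hident k r
  exact (DifferentiableOn.fun_sum fun s _ => hq j s).congr h

include hx hindep hident in
theorem dataProb_eq_prod_outcomeProb (u : ∀ i, Fin (R (g i))) {θ : ParamSpace D} (hθ : θ ∈ Θ) :
    dataProb P x (fun i => γ (g i)) u θ =
      ∏ j, outcomeProb P x (fun i => γ (g i)) j (fun l => u ⟨j, l⟩) θ := by
  rw [dataProb_eq_prod_cellProb hx (hindep θ hθ) (hident θ hθ), Fintype.prod_sigma]
  simp only [outcomeProb_eq_prod_cellProb hx (hindep θ hθ) (hident θ hθ)]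

include hg hP hx hindep hident in
theorem sum_dataProb_eq_one {θ : ParamSpace D} (hθ : θ ∈ Θ) :
    ∑ u, dataProb P x (fun i => γ (g i)) u θ = 1 := by
  classical
  simp only [dataProb_eq_prod_cellProb hx (hindep θ hθ) (hident θ hθ)]
  have h := Finset.prod_univ_sum (fun i => (Finset.univ : Finset (Fin (R (g i)))))
    fun i r => cellProb Pmodel γ (g i) r θ
  rw [Fintype.piFinset_univ] at h
  rw [← h]
  exact Finset.prod_eq_one fun i _ => sum_cellProb_eq_one hg hP hx hident θ hθ _

variable [Fintype κ] [∀ k, Nonempty (Fin (R k))] (hD : ∑ k, ((R k : ℤ) - 1) < D)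

include hg hP hx hindep hident hD in
theorem det_fisherInformation_eq_zero
    (hq : ∀ j s, TwiceDifferentiableOn (outcomeProb P x (fun i => γ (g i)) j s) Θ)
    {θ : ParamSpace D} (hθ : θ ∈ Θ) (hU : UniqueDiffWithinAt ℝ Θ θ) :
    (fisherInformation Θ P x (fun i => γ (g i)) θ).det = 0 := by
  have hc := differentiableOn_cellProb hg hP hx hindep hident
    fun j s => (hq j s).differentiableOn
  obtain ⟨v, hv, hv0⟩ := exists_ne_zero_forall_fderivWithin_apply_eq_zero (by simpa using hD)
    (sum_cellProb_eq_one hg hP hx hident) hc hθ hU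
  refine det_eq_zero_of_apply_eq_sum
    (α := Σ j, ∀ l : Fin (L j), Fin (R (g ⟨j, l⟩)))
    (fun a l => 1 / outcomeProb P x (fun i => γ (g i)) a.1 a.2 θ *
      partialWithin Θ l (outcomeProb P x (fun i => γ (g i)) a.1 a.2) θ)
    (fun a => fderivWithin ℝ (outcomeProb P x (fun i => γ (g i)) a.1 a.2) Θ θ)
    (fun l m => ?_) hv fun a => ?_
  · rw [fisherInformation, Matrix.of_apply, Fintype.sum_sigma]
    simp only [partialWithin, mul_assoc]
  · exact fderivWithin_apply_eq_zero_of_eqOn_prod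
      (fun η hη => outcomeProb_eq_prod_cellProb hx (hindep η hη) (hident η hη) a.1 a.2)
      (fun l => hc _ _) hθ hU fun l => hv0 _ _

include hg hP hx hindep hident hD in
theorem det_expectedNegHessian_eq_zero
    (hq : ∀ j s, TwiceDifferentiableOn (outcomeProb P x (fun i => γ (g i)) j s) Θ)
    {θ : ParamSpace D} (hθ : θ ∈ Θ) (hU : ∀ᶠ η in 𝓝[Θ] θ, UniqueDiffWithinAt ℝ Θ η)
    (hsupp : ∀ u, dataProb P x (fun i => γ (g i)) u θ ≠ 0 ∨
      ∀ᶠ η in 𝓝[Θ] θ, dataProb P x (fun i => γ (g i)) u η = 0) :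
    (expectedNegHessian Θ P x (fun i => γ (g i)) θ).det = 0 := by
  have hUθ : UniqueDiffWithinAt ℝ Θ θ := hU.self_of_nhdsWithin hθ
  have hc := differentiableOn_cellProb hg hP hx hindep hident
    fun j s => (hq j s).differentiableOn
  have hdata : ∀ u, TwiceDifferentiableOn (dataProb P x (fun i => γ (g i)) u) Θ := fun u =>
    (TwiceDifferentiableOn.finsetProd Finset.univ fun j _ => hq j fun l => u ⟨j, l⟩).congr
      fun η hη => dataProb_eq_prod_outcomeProb hx hindep hident u hη
  obtain ⟨v, hv, hv0⟩ := exists_ne_zero_forall_fderivWithin_apply_eq_zero (by simpa using hD)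
    (sum_cellProb_eq_one hg hP hx hident) hc hθ hUθ
  refine det_eq_zero_of_apply_eq_sum
    (fun u l => 1 / dataProb P x (fun i => γ (g i)) u θ *
      partialWithin Θ l (dataProb P x (fun i => γ (g i)) u) θ)
    (fun u => fderivWithin ℝ (dataProb P x (fun i => γ (g i)) u) Θ θ)
    (fun l m => ?_) hv fun u => ?_
  · rw [expectedNegHessian, Matrix.of_apply, neg_sum_mul_partialWithin_log_eq hdata
      (fun η hη => sum_dataProb_eq_one hg hP hx hindep hident hη) hθ hU hsupp]
    simp only [partialWithin, mul_assoc]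
  · exact fderivWithin_apply_eq_zero_of_eqOn_prod
      (fun η hη => dataProb_eq_prod_cellProb hx (hindep η hη) (hident η hη) u)
      (fun i => hc _ _) hθ hUθ fun i => hv0 _ _

include hg hP hx hindep hident hD in
theorem exists_mem_not_identifiablePoint
    (hq : ∀ j s, ContinuousOn (outcomeProb P x (fun i => γ (g i)) j s) Θ)
    {U : Set (ParamSpace D)} (hU : IsOpen U) (hne : U.Nonempty) (hUΘ : U ⊆ Θ) :
    ∃ θ ∈ U, ¬ IdentifiablePoint Θ P x (fun i => γ (g i)) θ := by
  obtain ⟨θ, hθ, θ', hθ', hne, heq⟩ := exists_ne_forall_eq_of_continuousOn (by simpa using hD)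
    (sum_cellProb_eq_one hg hP hx hident)
    (continuousOn_cellProb hg hP hx hindep hident hq) hU hne hUΘ
  refine ⟨θ, hθ, not_not.2 ⟨θ', ⟨hUΘ hθ', hne.symm⟩, hne, fun u => ?_⟩⟩
  rw [dataProb_eq_prod_cellProb hx (hindep θ (hUΘ hθ)) (hident θ (hUΘ hθ)),
    dataProb_eq_prod_cellProb hx (hindep θ' (hUΘ hθ')) (hident θ' (hUΘ hθ'))]
  simp only [heq]

end System

theorem theorem5 {D N : ℕ} {L : Fin N → ℕ}
    -- the parameter set, with nonempty interior
    (Θ : Set (ParamSpace D)) (hΘ : (interior Θ).Nonempty)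
    -- the grouping: `g i = ⟨w, t⟩` means that the subvector index `i` belongs to `A_w^(t)`
    {W : ℕ} {T : Fin W → ℕ} (g : SubvectorIndex L → Σ w : Fin W, Fin (T w))
    (hg : Function.Surjective g)
    -- the statistical models of the groups `A_w`
    {X : Fin W → Type*} [∀ w, MeasurableSpace (X w)]
    (Pmodel : ∀ w, ParamSpace D → Measure (X w))
    -- the quantizers of the subgroups `A_w^(t)`
    (R : ∀ w, Fin (T w) → ℕ) (γ : ∀ w t, VectorQuantizer (X w) (R w t))
    -- the observation subvectors: independent, the one of index `i` with the model of its group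
    {Ω : Type*} [MeasurableSpace Ω] (P : ParamSpace D → Measure Ω)
    (hP : ∀ θ ∈ Θ, IsProbabilityMeasure (P θ))
    (x : ∀ i, Ω → X (g i).1) (hx : ∀ i, Measurable (x i))
    (hindep : ∀ θ ∈ Θ, iIndepFun x (P θ))
    (hident : ∀ θ ∈ Θ, ∀ i, (P θ).map (x i) = Pmodel (g i).1 θ)
    -- the dimension condition
    (hD : ∑ w : Fin W, ∑ t : Fin (T w), ((R w t : ℤ) - 1) < (D : ℤ)) :
    -- singularity of the Fisher information matrix
    ((∀ j s, TwiceDifferentiableOn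
          (outcomeProb P x (fun i => γ (g i).1 (g i).2) j s) Θ) →
      (∀ θ ∈ Θ, UniqueDiffWithinAt ℝ Θ θ →
        (fisherInformation Θ P x (fun i => γ (g i).1 (g i).2) θ).det = 0) ∧
      (∀ θ ∈ Θ, (∀ᶠ η in 𝓝[Θ] θ, UniqueDiffWithinAt ℝ Θ η) →
        (∀ u, dataProb P x (fun i => γ (g i).1 (g i).2) u θ ≠ 0 ∨
          ∀ᶠ η in 𝓝[Θ] θ, dataProb P x (fun i => γ (g i).1 (g i).2) u η = 0) →
        (expectedNegHessian Θ P x (fun i => γ (g i).1 (g i).2) θ).det = 0)) ∧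
    -- nonidentifiability
    ((∀ j s, ContinuousOn (outcomeProb P x (fun i => γ (g i).1 (g i).2) j s) Θ) →
      ¬ IdentifiableSpace Θ P x (fun i => γ (g i).1 (g i).2) ∧
      ∀ U : Set (ParamSpace D), IsOpen U → U.Nonempty → U ⊆ Θ →
        {θ ∈ U | ¬ IdentifiablePoint Θ P x (fun i => γ (g i).1 (g i).2) θ}.Infinite) := by
  obtain ⟨θ₀, hθ₀⟩ := hΘ
  have := hP θ₀ (interior_subset hθ₀)
  have hΩ : Nonempty Ω := nonempty_of_isProbabilityMeasure (P θ₀)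
  have hR : ∀ k : Σ w : Fin W, Fin (T w), Nonempty (Fin (R k.1 k.2)) := by
    intro k
    obtain ⟨i, rfl⟩ := hg k
    have : Nonempty (X (g i).1) := hΩ.map (x i)
    exact (γ (g i).1 (g i).2).nonempty_fin
  have hD' : ∑ k : Σ w : Fin W, Fin (T w), ((R k.1 k.2 : ℤ) - 1) < D := by
    rwa [Fintype.sum_sigma]
  refine ⟨fun hq => ⟨fun θ hθ hU => ?_, fun θ hθ hU hsupp => ?_⟩, fun hq => ?_⟩
  · exact det_fisherInformation_eq_zero (κ := Σ w : Fin W, Fin (T w)) (X := fun k => X k.1)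
      (Pmodel := fun k => Pmodel k.1) (R := fun k => R k.1 k.2) (γ := fun k => γ k.1 k.2)
      hg hP hx hindep hident hD' hq hθ hU
  · exact det_expectedNegHessian_eq_zero (κ := Σ w : Fin W, Fin (T w)) (X := fun k => X k.1)
      (Pmodel := fun k => Pmodel k.1) (R := fun k => R k.1 k.2) (γ := fun k => γ k.1 k.2)
      hg hP hx hindep hident hD' hq hθ hU hsupp
  have hex : ∀ U : Set (ParamSpace D), IsOpen U → U.Nonempty → U ⊆ Θ →
      ∃ θ ∈ U, ¬ IdentifiablePoint Θ P x (fun i => γ (g i).1 (g i).2) θ := fun U hU hne hUΘ =>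
    exists_mem_not_identifiablePoint (κ := Σ w : Fin W, Fin (T w)) (X := fun k => X k.1)
      (Pmodel := fun k => Pmodel k.1) (R := fun k => R k.1 k.2) (γ := fun k => γ k.1 k.2)
      hg hP hx hindep hident hD' hq hU hne hUΘ
  refine ⟨fun h => ?_, fun U hU hne hUΘ hfin => ?_⟩
  · obtain ⟨θ, hθ, hid⟩ := hex _ isOpen_interior ⟨θ₀, hθ₀⟩ interior_subset
    exact hid (h θ (interior_subset hθ))
  · have hDpos : 0 < D := by
      have : 0 ≤ ∑ k : Σ w : Fin W, Fin (T w), ((R k.1 k.2 : ℤ) - 1) :=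
        Finset.sum_nonneg fun k _ => by
          have := Fin.pos_iff_nonempty.2 (hR k)
          omega
      omega
    have : Nonempty (Fin D) := ⟨⟨0, hDpos⟩⟩
    have hnt : Nontrivial (ParamSpace D) := inferInstance
    have hdiff : (U \ {θ ∈ U | ¬ IdentifiablePoint Θ P x (fun i => γ (g i).1 (g i).2) θ}).Nonempty :=
      ((infinite_of_mem_nhds _ (hU.mem_nhds hne.some_mem)).sdiff hfin).nonempty
    -- Removing finitely many bad points leaves a nonempty open set, as `D > 0`, and that set must
    -- contain another bad point.
    obtain ⟨θ, hθ, hid⟩ := hex _ (hU.sdiff hfin.isClosed) hdiff (Set.sdiff_subset.trans hUΘ)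
    exact hθ.2 ⟨hθ.1, hid⟩
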